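/- Let $\mathbb{F}_q$ be a finite field with $q$ elements and let $T$ be an indeterminate. Let $(\mathbb{F}_q(T))_\infty$ be the completion of $\mathbb{F}_q(T)$ with respect to the absolute value $|f|_\infty=q^{\deg f}$ (where $\deg(A/B)=\deg A-\deg B$ and $|0|_\infty=0$). For $M=\sum_i a_iT^i\in\mathbb{F}_q[T]$ the Carlitz action of $M$ on the algebraic closure $\overline{\mathbb{F}_q(T)}$ is $M\cdot_q u=\sum_i a_i(\phi_q+\mu_T)^i(u)$, where $(\phi_q+\mu_T)(u)=u^q+Tu$. Let $$\mathbb{T}_q=\{u\in\overline{\mathbb{F}_q(T)} : M\cdot_q u=0\text{ for some nonzero } M\in\mathbb{F}_q[T]\}$$ be the set of all torsion points of this action. Fix a branch $\mathfrak{P}$ of infinity, that is, an absolute value on $\overline{\mathbb{F}_q(T)}$ extending $|\cdot|_\infty$. Let the $q$-unit circle $\mathbb{S}_q$ be the closure of $\mathbb{T}_q$ in the completion $(\overline{\mathbb{F}_q(T)})_{\mathfrak{P}}$, and let $V_q=(\mathbb{F}_q(T))_\infty(\mathbb{S}_q)$ be the subfield of $(\overline{\mathbb{F}_q(T)})_{\mathfrak{P}}$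 generated by $\mathbb{S}_q$ over $(\mathbb{F}_q(T))_\infty$, with the $\mathfrak{P}$-adic metric. Then: 1. $\mathbb{S}_q$ is compact in the $\mathfrak{P}$-adic metric on $V_q$; 2. if $q>2$, then $\mathbb{S}_q$ is nowhere dense in $V_q$. -/

import Mathlib

open Polynomial

noncomputable section

namespace QCircle

variable (F : Type*) [Field F] [Fintype F]

/-- A fixed algebraic closure of the rational function field `𝔽_q(T)`, where `𝔽_q = F`. -/
abbrev AlgClosure : Type _ := AlgebraicClosure (RatFunc F)

/-- The absolute value of `𝔽_q(T)` at the infinite place: `|f| = q ^ deg f` for `f ≠ 0`, where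
`deg (A / B) = deg A - deg B`. -/
def inftyAbs : AbsoluteValue (RatFunc F) ℝ where
  toFun f := open Classical in if f = 0 then 0 else (Fintype.card F : ℝ) ^ f.intDegree
  map_mul' f g := by
    have hq : (Fintype.card F : ℝ) ≠ 0 := Nat.cast_ne_zero.mpr Fintype.card_ne_zero
    by_cases hf : f = 0
    · simp [hf]
    by_cases hg : g = 0
    · simp [hg]
    simp [hf, hg, RatFunc.intDegree_mul hf hg, zpow_add₀ hq]
  nonneg' f := by
    split_ifs <;> positivity
  eq_zero' f := by
    have hq : (Fintype.card F : ℝ) ≠ 0 := Nat.cast_ne_zero.mpr Fintype.card_ne_zero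
    by_cases hf : f = 0
    · simp [hf]
    · simp [hf, zpow_ne_zero]
  add_le' f g := by
    have hq : (1 : ℝ) ≤ Fintype.card F := by exact_mod_cast Fintype.card_pos
    by_cases hf : f = 0
    · split_ifs <;> simp_all
    by_cases hg : g = 0
    · split_ifs <;> simp_all
    by_cases hfg : f + g = 0
    · simp only [hfg, hf, hg, if_true, if_false]
      positivity
    simp only [hfg, hf, hg, if_false]
    rcases le_max_iff.mp (RatFunc.intDegree_add_le hg hfg) with h | h
    · exact (zpow_le_zpow_right₀ hq h).trans (le_add_of_nonneg_right (by positivity))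
    · exact (zpow_le_zpow_right₀ hq h).trans (le_add_of_nonneg_left (by positivity))

theorem inftyAbs_of_ne_zero {f : RatFunc F} (hf : f ≠ 0) :
    inftyAbs F f = (Fintype.card F : ℝ) ^ f.intDegree := by
  simp [inftyAbs, hf]

/-- The completion `(𝔽_q(T))_∞` of `𝔽_q(T)` at the infinite place. -/
abbrev KInfty : Type _ := (inftyAbs F).Completion

/-- The operator `φ_q + μ_T : u ↦ u ^ q + T u` on the algebraic closure, as an `𝔽_q`-linear map. -/
def carlitzT : Module.End F (AlgClosure F) :=
  (FiniteField.frobeniusAlgHom F (AlgClosure F)).toLinearMap +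
    LinearMap.mulLeft F (algebraMap (RatFunc F) (AlgClosure F) RatFunc.X)

theorem carlitzT_apply (u : AlgClosure F) :
    carlitzT F u =
      u ^ Fintype.card F + algebraMap (RatFunc F) (AlgClosure F) RatFunc.X * u := rfl

variable {F} in
/-- The Carlitz action `M ⬝ u = ∑ a_i (φ_q + μ_T)^i (u)` of a polynomial `M = ∑ a_i T^i`. -/
def carlitz (M : F[X]) : Module.End F (AlgClosure F) := aeval (carlitzT F) M

variable {F} in
theorem carlitz_apply (M : F[X]) (u : AlgClosure F) :
    carlitz M u = ∑ i ∈ Finset.range (M.natDegree + 1), M.coeff i • (carlitzT F)^[i] u := by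
  simp [carlitz, aeval_eq_sum_range, Module.End.pow_apply]

/-- The set `𝕋_q` of all roots of `q`-unity: torsion points of the Carlitz action. -/
def torsion : Set (AlgClosure F) := {u | ∃ M : F[X], M ≠ 0 ∧ carlitz M u = 0}

section Branch

variable {F}

/- A branch `𝔓` of infinity is an absolute value on the algebraic closure which extends the
absolute value of `𝔽_q(T)` at the infinite place, i.e. one with `𝔓.LiesOver (inftyAbs F)`. -/
variable (𝔓 : AbsoluteValue (AlgClosure F) ℝ)

/-- The `q`-unit circle `𝕊_q`: the completion of `𝕋_q` at `𝔓`, that is, the closure of `𝕋_q`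
in the completion of the algebraic closure at `𝔓`. -/
def unitCircle : Set 𝔓.Completion :=
  closure ((fun u => ((WithAbs.toAbs 𝔓 u : WithAbs 𝔓) : 𝔓.Completion)) '' torsion F)

variable [h𝔓 : 𝔓.LiesOver (inftyAbs F)]

theorem isometry_map : Isometry (WithAbs.map (inftyAbs F) 𝔓
    (algebraMap (RatFunc F) (AlgClosure F))) := by
  refine AddMonoidHomClass.isometry_of_norm _ fun x => ?_
  exact DFunLike.congr_fun (AbsoluteValue.LiesOver.comp_eq 𝔓 (inftyAbs F)) x.ofAbs

/-- The embedding of `(𝔽_q(T))_∞` into the completion of the algebraic closure at `𝔓` which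
extends the inclusion of `𝔽_q(T)` by continuity. -/
def completionMap : KInfty F →+* 𝔓.Completion :=
  UniformSpace.Completion.mapRingHom _ (isometry_map 𝔓).continuous

theorem isometry_completionMap : Isometry (completionMap 𝔓) :=
  (isometry_map 𝔓).completion_map

theorem completionMap_coe (x : RatFunc F) :
    completionMap 𝔓 (WithAbs.toAbs (inftyAbs F) x : WithAbs (inftyAbs F)) =
      (WithAbs.toAbs 𝔓 (algebraMap (RatFunc F) (AlgClosure F) x) : WithAbs 𝔓) :=
  UniformSpace.Completion.mapRingHom_coe (isometry_map 𝔓).continuous _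

instance completionAlgebra : Algebra (KInfty F) 𝔓.Completion := (completionMap 𝔓).toAlgebra

/-- The field `V_q = (𝔽_q(T))_∞(𝕊_q)`, with the `𝔓`-adic metric it inherits from the completion
of the algebraic closure at `𝔓`. -/
def V : IntermediateField (KInfty F) 𝔓.Completion :=
  IntermediateField.adjoin (KInfty F) (unitCircle 𝔓)

theorem unitCircle_subset_V : unitCircle 𝔓 ⊆ V 𝔓 := IntermediateField.subset_adjoin _ _

/-- The `q`-unit circle as a subset of `V_q`. -/
def unitCircleInV : Set (V 𝔓) := {x | (x : 𝔓.Completion) ∈ unitCircle 𝔓}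

end Branch

end QCircle

end

open Polynomial

namespace QCircle

/-! ### The branch is ultrametric, and torsion orbits are bounded. -/

section AbsoluteValue

variable {F : Type*} [Field F] [Fintype F] (𝔓 : AbsoluteValue (AlgClosure F) ℝ)
  [h𝔓 : 𝔓.LiesOver (inftyAbs F)]

/-! Fix `l` with `l ^ (q - 1) = -T`; for `u = l * w` the action of `T` becomes `w ↦ T (w - w ^ q)`
(`carlitzT_mul`). A torsion orbit is bounded, which forces `|w| ≤ 1`. Writing `w = T⁻¹ * (T (w - w ^
q)) + w ^ q`, where `T (w - w ^ q)` is again torsion divided by `l`, approximations of `w` improve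
recursively, with finitely many rational functions at each precision
(`exists_finite_ratFunc_approx`). So the circle is totally bounded, hence compact, and lies in `l *
K_∞`. When `q > 2`, `|l| = q ^ (1 / (q - 1))` is not in the value group, so `l ∉ K_∞`; a ball of `V`
inside the circle would contain two points with nonzero difference in `K_∞ ∩ l * K_∞`, giving `l ∈
K_∞`. -/

theorem abs_algebraMap_ratFunc (x : RatFunc F) :
    𝔓 (algebraMap (RatFunc F) (AlgClosure F) x) = inftyAbs F x :=
  DFunLike.congr_fun (AbsoluteValue.LiesOver.comp_eq 𝔓 (inftyAbs F)) x

theorem abs_algebraMap_X :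
    𝔓 (algebraMap (RatFunc F) (AlgClosure F) RatFunc.X) = Fintype.card F := by
  rw [abs_algebraMap_ratFunc, inftyAbs_of_ne_zero F RatFunc.X_ne_zero, RatFunc.intDegree_X,
    zpow_one]

theorem inftyAbs_algebraMap {c : F} (hc : c ≠ 0) : inftyAbs F (algebraMap F (RatFunc F) c) = 1 := by
  have h : algebraMap F (RatFunc F) c = RatFunc.C c := rfl
  rw [h, inftyAbs_of_ne_zero F (by simpa using hc), RatFunc.intDegree_C, zpow_zero]

theorem abs_algebraMap_le_one (c : F) : 𝔓 (algebraMap F (AlgClosure F) c) ≤ 1 := by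
  rcases eq_or_ne c 0 with rfl | hc
  · simp
  · rw [IsScalarTower.algebraMap_apply F (RatFunc F), abs_algebraMap_ratFunc,
      inftyAbs_algebraMap hc]

/-- Natural numbers map into the constants `F`, so their absolute values are at most 1. -/
theorem isNonarchimedean_abs : IsNonarchimedean 𝔓 := by
  have : IsUltrametricDist (WithAbs 𝔓) := by
    refine IsUltrametricDist.isUltrametricDist_of_forall_norm_natCast_le_one fun n => ?_
    have h := abs_algebraMap_le_one 𝔓 (n : F)
    rw [map_natCast] at h
    exact h
  intro a b
  exact IsUltrametricDist.norm_add_le_max (WithAbs.toAbs 𝔓 a) (WithAbs.toAbs 𝔓 b)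

/-- The orbit of a torsion point under the Carlitz action of `T` is `𝔓`-adically bounded. -/
theorem exists_abs_iterate_carlitzT_le {u : AlgClosure F} (hu : u ∈ torsion F) :
    ∃ B : ℝ, ∀ n : ℕ, 𝔓 ((carlitzT F ^ n) u) ≤ B := by
  obtain ⟨M, hM, hMu⟩ := hu
  refine ⟨∑ i ∈ Finset.range M.natDegree, 𝔓 ((carlitzT F ^ i) u), fun n => ?_⟩
  -- Only the residue of `X ^ n` modulo the annihilator matters.
  have hcongr : (carlitzT F ^ n) u = carlitz (X ^ n % M) u := by
    have h := congrArg (fun N : F[X] => carlitz N u) (EuclideanDomain.div_add_mod (X ^ n) M)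
    simp only [carlitz, map_add, mul_comm M, map_mul, map_pow, aeval_X, LinearMap.add_apply,
      Module.End.mul_apply] at h
    change aeval (carlitzT F) M u = 0 at hMu
    rw [hMu, map_zero, zero_add] at h
    exact h.symm
  rcases Nat.eq_zero_or_pos M.natDegree with h0 | hpos
  · obtain ⟨c, rfl⟩ := natDegree_eq_zero.mp h0
    have : u = 0 := by
      have hc : c ≠ 0 := by simpa using hM
      simpa [carlitz, hc] using hMu
    simp [this]
  · have hdeg : (X ^ n % M).natDegree < M.natDegree := natDegree_mod_lt _ hpos.ne'
    rw [hcongr, carlitz, aeval_eq_sum_range' hdeg, LinearMap.sum_apply]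
    refine (𝔓.sum_le _ _).trans (Finset.sum_le_sum fun i _ => ?_)
    rw [LinearMap.smul_apply, Algebra.smul_def, map_mul]
    exact mul_le_of_le_one_left (𝔓.nonneg _) (abs_algebraMap_le_one 𝔓 _)

theorem carlitzT_mem_torsion {u : AlgClosure F} (hu : u ∈ torsion F) :
    carlitzT F u ∈ torsion F := by
  obtain ⟨M, hM, hMu⟩ := hu
  refine ⟨M, hM, ?_⟩
  have h : carlitz M * carlitzT F = carlitzT F * carlitz M := by
    have h' := congrArg (aeval (carlitzT F)) (mul_comm M X)
    rwa [map_mul, map_mul, aeval_X] at h'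
  rw [← Module.End.mul_apply, h, Module.End.mul_apply, hMu, map_zero]

end AbsoluteValue

/-! ### Rescaling by `l` and approximation by rational functions. -/

section Approximation

variable {F : Type*} [Field F] [Fintype F]

theorem sub_pow_card (a b : AlgClosure F) :
    (a - b) ^ Fintype.card F = a ^ Fintype.card F - b ^ Fintype.card F :=
  map_sub (FiniteField.frobeniusAlgHom F (AlgClosure F)) a b

theorem algebraMap_pow_card (c : F) :
    algebraMap F (AlgClosure F) c ^ Fintype.card F = algebraMap F (AlgClosure F) c := by
  rw [← map_pow, FiniteField.pow_card]

theorem pow_card_sub_self_eq_prod (w : AlgClosure F) :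
    w ^ Fintype.card F - w = ∏ c : F, (w - algebraMap F (AlgClosure F) c) := by
  have hmonic : (X ^ Fintype.card F - X : F[X]).Monic :=
    monic_X_pow_sub (by simpa using Fintype.one_lt_card)
  have hprod := prod_multiset_X_sub_C_of_monic_of_roots_card_eq hmonic (by
    rw [FiniteField.roots_X_pow_card_sub_X,
      FiniteField.X_pow_card_sub_X_natDegree_eq F Fintype.one_lt_card]
    rfl)
  rw [FiniteField.roots_X_pow_card_sub_X] at hprod
  have h := congrArg (aeval w) hprod
  change aeval w (∏ c : F, (X - C c)) = _ at h
  simpa [map_prod] using h.symm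

variable (F) in
theorem exists_pow_card_sub_one_eq_neg_X : ∃ l : AlgClosure F,
    l ^ (Fintype.card F - 1) = -algebraMap (RatFunc F) (AlgClosure F) RatFunc.X :=
  IsAlgClosed.exists_pow_nat_eq _ (Nat.sub_pos_of_lt Fintype.one_lt_card)

variable {l : AlgClosure F}
  (hl : l ^ (Fintype.card F - 1) = -algebraMap (RatFunc F) (AlgClosure F) RatFunc.X)

include hl

theorem ne_zero_of_pow_eq_neg_X : l ≠ 0 := by
  rintro rfl
  rw [zero_pow (Nat.sub_pos_of_lt Fintype.one_lt_card).ne', eq_comm, neg_eq_zero,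
    map_eq_zero] at hl
  exact RatFunc.X_ne_zero hl

theorem carlitzT_mul (w : AlgClosure F) :
    carlitzT F (l * w) =
      l * (algebraMap (RatFunc F) (AlgClosure F) RatFunc.X * (w - w ^ Fintype.card F)) := by
  have h : l ^ Fintype.card F = l * l ^ (Fintype.card F - 1) := by
    rw [← pow_succ', Nat.sub_add_cancel Fintype.card_pos]
  rw [carlitzT_apply, mul_pow, h, hl]
  ring

variable (𝔓 : AbsoluteValue (AlgClosure F) ℝ) [h𝔓 : 𝔓.LiesOver (inftyAbs F)]

/-- If `|w| > 1`, then `w ^ q` dominates `w`, and the factor `|T| = q ≥ 2` gives the expansion that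
makes an orbit escape. -/
theorem two_mul_abs_le_abs_carlitzT {u : AlgClosure F} (hu : 𝔓 l < 𝔓 u) :
    2 * 𝔓 u ≤ 𝔓 (carlitzT F u) := by
  have hl0 := ne_zero_of_pow_eq_neg_X hl
  obtain ⟨w, rfl⟩ : ∃ w, u = l * w := ⟨u / l, by field_simp⟩
  have hlpos : 0 < 𝔓 l := 𝔓.pos hl0
  have hw : 1 < 𝔓 w := by
    rw [map_mul] at hu
    exact (lt_mul_iff_one_lt_right hlpos).mp hu
  have hlt : 𝔓 (w) < 𝔓 (-w ^ Fintype.card F) := by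
    rw [map_neg_eq_map, map_pow]
    exact lt_self_pow₀ hw Fintype.one_lt_card
  have hq : (2 : ℝ) ≤ Fintype.card F := by exact_mod_cast Fintype.one_lt_card
  rw [carlitzT_mul hl, map_mul, map_mul, map_mul, abs_algebraMap_X, sub_eq_add_neg,
    (isNonarchimedean_abs 𝔓).add_eq_right_of_lt hlt, mul_left_comm]
  gcongr

theorem abs_le_of_mem_torsion {u : AlgClosure F} (hu : u ∈ torsion F) : 𝔓 u ≤ 𝔓 l := by
  by_contra! h
  obtain ⟨B, hB⟩ := exists_abs_iterate_carlitzT_le 𝔓 hu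
  have key : ∀ n : ℕ, 2 ^ n * 𝔓 u ≤ 𝔓 ((carlitzT F ^ n) u) := by
    intro n
    induction n with
    | zero => simp
    | succ n ih =>
      have h1 : 𝔓 u ≤ 2 ^ n * 𝔓 u :=
        le_mul_of_one_le_left (𝔓.nonneg _) (one_le_pow₀ one_le_two)
      have h2 := two_mul_abs_le_abs_carlitzT hl 𝔓 (h.trans_le (h1.trans ih))
      rw [pow_succ' (carlitzT F), Module.End.mul_apply]
      calc _ = 2 * (2 ^ n * 𝔓 u) := by ring
        _ ≤ _ := by gcongr
        _ ≤ _ := h2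
  have hupos : 0 < 𝔓 u := (𝔓.nonneg l).trans_lt h
  obtain ⟨n, hn⟩ := pow_unbounded_of_one_lt (B / 𝔓 u) (one_lt_two (α := ℝ))
  rw [div_lt_iff₀ hupos] at hn
  exact absurd ((key n).trans (hB n)) (not_le.mpr hn)

theorem abs_le_one_of_mul_mem_torsion {w : AlgClosure F} (hw : l * w ∈ torsion F) : 𝔓 w ≤ 1 := by
  have h := abs_le_of_mem_torsion hl 𝔓 hw
  rw [map_mul] at h
  exact (mul_le_iff_le_one_right (𝔓.pos (ne_zero_of_pow_eq_neg_X hl))).mp h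

theorem mul_mul_mem_torsion {w : AlgClosure F} (hw : l * w ∈ torsion F) :
    l * (algebraMap (RatFunc F) (AlgClosure F) RatFunc.X * (w - w ^ Fintype.card F)) ∈
      torsion F := by
  rw [← carlitzT_mul hl]
  exact carlitzT_mem_torsion hw

/-- The bound `|T (w - w ^ q)| ≤ 1` makes `∏ (w - c)` small, so some factor `v = w - c` has `|v| <
1`; then `v` dominates `v ^ q`, and `|v| = |w - w ^ q|`. -/
theorem exists_abs_sub_algebraMap_le {w : AlgClosure F} (hw : l * w ∈ torsion F) :
    ∃ c : F, 𝔓 (w - algebraMap F (AlgClosure F) c) ≤ (Fintype.card F : ℝ)⁻¹ := by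
  have hq : (1 : ℝ) < Fintype.card F := by exact_mod_cast Fintype.one_lt_card
  have h1 : 𝔓 (w - w ^ Fintype.card F) ≤ (Fintype.card F : ℝ)⁻¹ := by
    have h := abs_le_one_of_mul_mem_torsion hl 𝔓 (mul_mul_mem_torsion hl hw)
    rw [map_mul, abs_algebraMap_X] at h
    rwa [← one_div, le_div_iff₀' (zero_lt_one.trans hq)]
  have h2 : ∃ c : F, 𝔓 (w - algebraMap F (AlgClosure F) c) < 1 := by
    by_contra! hc
    have h3 : 1 ≤ 𝔓 (w ^ Fintype.card F - w) := by
      rw [pow_card_sub_self_eq_prod, map_prod]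
      exact Finset.one_le_prod fun c _ => hc c
    rw [𝔓.map_sub] at h3
    exact absurd (h3.trans h1) (not_le.mpr (inv_lt_one_of_one_lt₀ hq))
  obtain ⟨c, hc⟩ := h2
  refine ⟨c, ?_⟩
  set v := w - algebraMap F (AlgClosure F) c with hv
  have hvv : w - w ^ Fintype.card F = v + -v ^ Fintype.card F := by
    rw [hv, sub_pow_card, algebraMap_pow_card]
    ring
  rcases eq_or_ne v 0 with h0 | h0
  · rw [h0, map_zero]
    positivity
  have hlt : 𝔓 (-v ^ Fintype.card F) < 𝔓 v := by
    rw [map_neg_eq_map, map_pow]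
    exact pow_lt_self_of_lt_one₀ (𝔓.pos h0) hc Fintype.one_lt_card
  rwa [hvv, (isNonarchimedean_abs 𝔓).add_eq_left_of_lt hlt] at h1

/-- Torsion points divided by `l` are uniformly approximated by finitely many rational functions. -/
theorem exists_finite_ratFunc_approx (n : ℕ) :
    ∃ N : Set (RatFunc F), N.Finite ∧ ∀ w : AlgClosure F, l * w ∈ torsion F →
      ∃ x ∈ N, 𝔓 (w - algebraMap (RatFunc F) (AlgClosure F) x) ≤
        (Fintype.card F : ℝ)⁻¹ ^ (n + 1) := by
  have hq : (1 : ℝ) < Fintype.card F := by exact_mod_cast Fintype.one_lt_card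
  induction n with
  | zero =>
    refine ⟨Set.range (algebraMap F (RatFunc F)), Set.finite_range _, fun w hw => ?_⟩
    obtain ⟨c, hc⟩ := exists_abs_sub_algebraMap_le hl 𝔓 hw
    refine ⟨_, ⟨c, rfl⟩, ?_⟩
    rwa [← IsScalarTower.algebraMap_apply, zero_add, pow_one]
  | succ n ih =>
    obtain ⟨N, hN, happ⟩ := ih
    -- Here `x` approximates `T (w - w ^ q)` and `y` approximates `w`: division by `T` gains one
    -- factor `q⁻¹`, and Frobenius raises the error to the power `q`.
    refine ⟨Set.image2 (fun x y => x / RatFunc.X + y ^ Fintype.card F) N N,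
      hN.image2 _ hN, fun w hw => ?_⟩
    obtain ⟨x, hx, hxw⟩ := happ _ (mul_mul_mem_torsion hl hw)
    obtain ⟨y, hy, hyw⟩ := happ w hw
    refine ⟨_, ⟨x, hx, y, hy, rfl⟩, ?_⟩
    have hX : algebraMap (RatFunc F) (AlgClosure F) RatFunc.X ≠ 0 := by
      simpa using RatFunc.X_ne_zero
    have hdecomp : w - algebraMap (RatFunc F) (AlgClosure F) (x / RatFunc.X + y ^ Fintype.card F) =
        (algebraMap (RatFunc F) (AlgClosure F) RatFunc.X)⁻¹ *
          (algebraMap (RatFunc F) (AlgClosure F) RatFunc.X * (w - w ^ Fintype.card F) -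
            algebraMap (RatFunc F) (AlgClosure F) x) +
          (w - algebraMap (RatFunc F) (AlgClosure F) y) ^ Fintype.card F := by
      rw [sub_pow_card, map_add, map_div₀, map_pow]
      field_simp
      ring
    rw [hdecomp]
    refine (isNonarchimedean_abs 𝔓 _ _).trans (max_le ?_ ?_)
    · rw [map_mul, map_inv₀, abs_algebraMap_X, pow_succ' _ (n + 1)]
      gcongr
    · rw [map_pow]
      calc _ ≤ ((Fintype.card F : ℝ)⁻¹ ^ (n + 1)) ^ Fintype.card F := by gcongr
        _ = (Fintype.card F : ℝ)⁻¹ ^ ((n + 1) * Fintype.card F) := (pow_mul _ _ _).symm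
        _ ≤ _ := by
          refine pow_le_pow_of_le_one (by positivity) (inv_le_one_of_one_le₀ hq.le) ?_
          have : 2 ≤ Fintype.card F := Fintype.one_lt_card
          nlinarith

/-- For `q > 2` the value group of `𝔽_q(T)` does not contain `|l| = q ^ (1 / (q - 1))`. -/
theorem abs_sub_algebraMap_ge (h2 : 2 < Fintype.card F) (x : RatFunc F) :
    𝔓 l ≤ 𝔓 (l - algebraMap (RatFunc F) (AlgClosure F) x) := by
  by_contra! h
  have hx : 𝔓 (algebraMap (RatFunc F) (AlgClosure F) x) = 𝔓 l := by
    rw [𝔓.map_sub] at h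
    simpa using (isNonarchimedean_abs 𝔓).add_eq_right_of_lt h
  have hq : (1 : ℝ) < Fintype.card F := by exact_mod_cast Fintype.one_lt_card
  have hx0 : x ≠ 0 := by
    rintro rfl
    rw [map_zero, map_zero, eq_comm] at hx
    exact ne_zero_of_pow_eq_neg_X hl ((map_eq_zero 𝔓).mp hx)
  have hpow := congrArg 𝔓 hl
  rw [map_neg_eq_map, abs_algebraMap_X, map_pow, ← hx, abs_algebraMap_ratFunc,
    inftyAbs_of_ne_zero F hx0, ← zpow_natCast, ← zpow_mul] at hpow
  have hexp : x.intDegree * ((Fintype.card F - 1 : ℕ) : ℤ) = 1 :=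
    zpow_right_injective₀ (by linarith) hq.ne' (by simpa using hpow)
  -- The integer `q - 1` would be a unit, so `q = 2`.
  have := Int.isUnit_iff.mp (IsUnit.of_mul_eq_one_right _ hexp)
  omega

end Approximation

/-! ### Passage to the completion: compactness and empty interior. -/

section Completion

variable {F : Type*} [Field F] [Fintype F] (𝔓 : AbsoluteValue (AlgClosure F) ℝ)
  [h𝔓 : 𝔓.LiesOver (inftyAbs F)]

omit [Fintype F] h𝔓 in
theorem dist_coe_completion (a b : AlgClosure F) :
    dist (WithAbs.toAbs 𝔓 a : 𝔓.Completion) (WithAbs.toAbs 𝔓 b : 𝔓.Completion) = 𝔓 (a - b) := by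
  rw [UniformSpace.Completion.dist_eq, dist_eq_norm]
  rfl

theorem exists_finite_torsion_approx {l : AlgClosure F}
    (hl : l ^ (Fintype.card F - 1) = -algebraMap (RatFunc F) (AlgClosure F) RatFunc.X)
    {ε : ℝ} (hε : 0 < ε) : ∃ N : Set (RatFunc F), N.Finite ∧ ∀ u ∈ torsion F,
      ∃ x ∈ N, 𝔓 (u - l * algebraMap (RatFunc F) (AlgClosure F) x) < ε := by
  have hl0 := ne_zero_of_pow_eq_neg_X hl
  have hq : (1 : ℝ) < Fintype.card F := by exact_mod_cast Fintype.one_lt_card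
  obtain ⟨n, hn⟩ := exists_pow_lt_of_lt_one (div_pos hε (𝔓.pos hl0)) (inv_lt_one_of_one_lt₀ hq)
  obtain ⟨N, hN, happ⟩ := exists_finite_ratFunc_approx hl 𝔓 n
  refine ⟨N, hN, fun u hu => ?_⟩
  obtain ⟨w, rfl⟩ : ∃ w, u = l * w := ⟨u / l, by field_simp⟩
  obtain ⟨x, hx, hxw⟩ := happ w hu
  refine ⟨x, hx, ?_⟩
  rw [← mul_sub, map_mul, mul_comm, ← lt_div_iff₀ (𝔓.pos hl0)]
  refine (hxw.trans ?_).trans_lt hn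
  exact pow_le_pow_of_le_one (by positivity) (inv_le_one_of_one_le₀ hq.le) n.le_succ

theorem isCompact_unitCircle : IsCompact (unitCircle 𝔓) := by
  obtain ⟨l, hl⟩ := exists_pow_card_sub_one_eq_neg_X F
  refine TotallyBounded.isCompact_of_isClosed (TotallyBounded.closure ?_) isClosed_closure
  rw [Metric.totallyBounded_iff]
  intro ε hε
  obtain ⟨N, hN, happ⟩ := exists_finite_torsion_approx 𝔓 hl hε
  refine ⟨(fun x : RatFunc F => (WithAbs.toAbs 𝔓 (l * algebraMap (RatFunc F) (AlgClosure F) x) :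
    𝔓.Completion)) '' N, hN.image _, ?_⟩
  rintro _ ⟨u, hu, rfl⟩
  obtain ⟨x, hx, hux⟩ := happ u hu
  simp only [Set.mem_iUnion]
  refine ⟨_, ⟨x, hx, rfl⟩, ?_⟩
  rw [Metric.mem_ball, dist_coe_completion]
  exact hux

theorem isClosed_range_completionMap : IsClosed (Set.range (completionMap 𝔓)) :=
  (isometry_completionMap 𝔓).isClosedEmbedding.isClosed_range

/-- Torsion divided by `l` is a limit of rational functions, and `K_∞` is complete, hence closed. -/
theorem unitCircle_subset_mul_range {l : AlgClosure F}
    (hl : l ^ (Fintype.card F - 1) = -algebraMap (RatFunc F) (AlgClosure F) RatFunc.X) :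
    unitCircle 𝔓 ⊆
      ((WithAbs.toAbs 𝔓 l : 𝔓.Completion)⁻¹ * ·) ⁻¹' Set.range (completionMap 𝔓) := by
  have hl0 := ne_zero_of_pow_eq_neg_X hl
  refine closure_minimal ?_ ((isClosed_range_completionMap 𝔓).preimage (continuous_const_mul _))
  rintro _ ⟨u, hu, rfl⟩
  rw [Set.mem_preimage, ← (isClosed_range_completionMap 𝔓).closure_eq, Metric.mem_closure_iff]
  intro ε hε
  obtain ⟨N, -, happ⟩ := exists_finite_torsion_approx 𝔓 hl (mul_pos (𝔓.pos hl0) hε)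
  obtain ⟨x, -, hx⟩ := happ u hu
  refine ⟨_, ⟨(WithAbs.toAbs (inftyAbs F) x : WithAbs (inftyAbs F)), rfl⟩, ?_⟩
  have hcoe : (WithAbs.toAbs 𝔓 l : 𝔓.Completion)⁻¹ * (WithAbs.toAbs 𝔓 u : 𝔓.Completion) =
      (WithAbs.toAbs 𝔓 (l⁻¹ * u) : 𝔓.Completion) := by
    rw [UniformSpace.Completion.coe_inv, ← UniformSpace.Completion.coe_mul]
    rfl
  rw [completionMap_coe, hcoe, dist_coe_completion]
  refine lt_of_mul_lt_mul_left ?_ (𝔓.nonneg l)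
  rwa [← map_mul, mul_sub, mul_inv_cancel_left₀ hl0]

theorem coe_notMem_range_completionMap {l : AlgClosure F}
    (hl : l ^ (Fintype.card F - 1) = -algebraMap (RatFunc F) (AlgClosure F) RatFunc.X)
    (h2 : 2 < Fintype.card F) :
    (WithAbs.toAbs 𝔓 l : 𝔓.Completion) ∉ Set.range (completionMap 𝔓) := by
  rintro ⟨k, hk⟩
  obtain ⟨_, ⟨x, rfl⟩, hx⟩ := Metric.mem_closure_iff.mp
    (UniformSpace.Completion.denseRange_coe (α := WithAbs (inftyAbs F)) k)
    (𝔓 l) (𝔓.pos (ne_zero_of_pow_eq_neg_X hl))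
  obtain ⟨x, rfl⟩ := WithAbs.toAbs_surjective _ x
  rw [← (isometry_completionMap 𝔓).dist_eq, hk, completionMap_coe, dist_coe_completion] at hx
  exact absurd (abs_sub_algebraMap_ge hl 𝔓 h2 x) (not_le.mpr hx)

theorem isCompact_unitCircleInV : IsCompact (unitCircleInV 𝔓) := by
  refine Topology.IsInducing.subtypeVal.isCompact_preimage' (isCompact_unitCircle 𝔓) ?_
  rw [Subtype.range_coe]
  exact unitCircle_subset_V 𝔓

theorem isNowhereDense_unitCircleInV (h2 : 2 < Fintype.card F) :
    IsNowhereDense (unitCircleInV 𝔓) := by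
  obtain ⟨l, hl⟩ := exists_pow_card_sub_one_eq_neg_X F
  have hl0 : (WithAbs.toAbs 𝔓 l : 𝔓.Completion) ≠ 0 := by
    rw [← norm_pos_iff, UniformSpace.Completion.norm_coe]
    exact 𝔓.pos (ne_zero_of_pow_eq_neg_X hl)
  rw [IsNowhereDense, (isCompact_unitCircleInV 𝔓).isClosed.closure_eq,
    Set.eq_empty_iff_forall_notMem]
  intro x hx
  have hsub := unitCircle_subset_mul_range 𝔓 hl
  have hq : (1 : ℝ) < Fintype.card F := by exact_mod_cast Fintype.one_lt_card
  obtain ⟨ε, hε, hball⟩ := Metric.mem_nhds_iff.mp (mem_interior_iff_mem_nhds.mp hx)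
  obtain ⟨n, hn⟩ := exists_pow_lt_of_lt_one hε (inv_lt_one_of_one_lt₀ hq)
  -- Translation by `T⁻ⁿ`, of norm `q⁻ⁿ < ε`, stays in the ball around `x`.
  let t : KInfty F := ↑(WithAbs.toAbs (inftyAbs F) (RatFunc.X⁻¹ ^ n) : WithAbs (inftyAbs F))
  have htn : ‖completionMap 𝔓 t‖ = (Fintype.card F : ℝ)⁻¹ ^ n := by
    rw [completionMap_coe, UniformSpace.Completion.norm_coe]
    change 𝔓 (algebraMap (RatFunc F) (AlgClosure F) (RatFunc.X⁻¹ ^ n)) = _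
    rw [map_pow, map_inv₀, map_pow, map_inv₀, abs_algebraMap_X]
  have htmem : completionMap 𝔓 t ∈ V 𝔓 := (V 𝔓).algebraMap_mem t
  have hxt : x + ⟨_, htmem⟩ ∈ unitCircleInV 𝔓 := by
    refine hball ?_
    rw [Metric.mem_ball, Subtype.dist_eq, dist_eq_norm]
    simpa [htn] using hn
  obtain ⟨a, ha⟩ := hsub (hball (Metric.mem_ball_self hε))
  obtain ⟨b, hb⟩ := hsub hxt
  have ht0 : completionMap 𝔓 t ≠ 0 := by
    rw [← norm_pos_iff, htn]
    positivity
  -- From `x = l * a` and `x + t = l * b` one gets `l = t / (b - a)`.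
  refine coe_notMem_range_completionMap 𝔓 hl h2 ⟨t / (b - a), ?_⟩
  have hba : completionMap 𝔓 (b - a) =
      (WithAbs.toAbs 𝔓 l : 𝔓.Completion)⁻¹ * completionMap 𝔓 t := by
    rw [map_sub, ha, hb, ← mul_sub]
    simp
  rw [map_div₀, hba]
  field_simp

end Completion

end QCircle

theorem mainTheorem7 {F : Type*} [Field F] [Fintype F]
    (𝔓 : AbsoluteValue (QCircle.AlgClosure F) ℝ) [𝔓.LiesOver (QCircle.inftyAbs F)] :
    IsCompact (QCircle.unitCircleInV 𝔓) ∧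
      (2 < Fintype.card F → IsNowhereDense (QCircle.unitCircleInV 𝔓)) :=
  ⟨QCircle.isCompact_unitCircleInV 𝔓, QCircle.isNowhereDense_unitCircleInV 𝔓⟩
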